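/- For real $X \ge 1$ let $$\Gamma(X)=\sum_{1\le n\le X}\mu^2(n^2+1)\,\mu^2(n^2+2)\,\mu^2(n^2+3),$$ where $n$ runs over the positive integers and $\mu$ is the Möbius function; thus $\Gamma(X)$ is the number of positive integers $n\le X$ for which $n^2+1$, $n^2+2$ and $n^2+3$ are all squarefree. Then there exist constants $\alpha>0.1477$ and $X_0$ such that $\Gamma(X)>\alpha X$ for all real $X\ge X_0$. -/

import Mathlib

open Filter

/-- `Γ(X) = ∑_{n ≤ X} μ²(n² + 1) μ²(n² + 2) μ²(n² + 3)`, for real `X`, where `n` runs over the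
positive integers and `μ` is the Möbius function. -/
noncomputable def squarefreeTripleSum (X : ℝ) : ℤ :=
  ∑ n ∈ Finset.Icc 1 ⌊X⌋₊,
    (ArithmeticFunction.moebius (n ^ 2 + 1)) ^ 2 * (ArithmeticFunction.moebius (n ^ 2 + 2)) ^ 2 *
      (ArithmeticFunction.moebius (n ^ 2 + 3)) ^ 2

/-! Even n = 2m alone suffice, and for them a union bound over primes is enough. Since 4 divides n²,
no n² + a with 1 ≤ a ≤ 3 is divisible by 4. Modulo 9 only a = 2 can fail, and modulo 25 only a = 1.
For p ≥ 7 each a excludes at most two classes of m modulo p² (`card_rootsUpTo_sq_le`). The excluded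
proportion is at most 2/9 + 2/25 + 6 ∑_{p ≥ 7} 1/p² < 0.667. Only p ≤ 2M matter when m ≤ M, so the
rounding errors total O(π(2M)) = o(M) by Chebyshev. Over a third of the even n, nearly, survive:
density above 0.15 among all n. -/

/-- At most `M / q + 1` of the integers `1, …, M` lie in a given residue class modulo `q`. -/
lemma card_filter_dvd_sub_le (M q : ℕ) (hq : 0 < q) (v : ℤ) :
    (((Finset.Ioc 0 M).filter fun m : ℕ => (q : ℤ) ∣ (m : ℤ) - v).card : ℝ) ≤ M / q + 1 := by
  have hq' : (0 : ℤ) < q := by exact_mod_cast hq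
  obtain ⟨w, hw⟩ := Int.eq_ofNat_of_zero_le (Int.emod_nonneg v hq'.ne')
  have hset : ((Finset.Ioc 0 M).filter fun m : ℕ => (q : ℤ) ∣ (m : ℤ) - v) =
      (Finset.Ioc 0 M).filter fun m : ℕ => m ≡ w [MOD q] := by
    refine Finset.filter_congr fun m _ => ?_
    rw [← Int.natCast_modEq_iff, ← hw, Int.modEq_comm, Int.modEq_iff_dvd, Int.emod_def]
    rw [show (m : ℤ) - (v - q * (v / q)) = (m - v) + q * (v / q) by ring,
      dvd_add_left (dvd_mul_right _ _)]
  have h := Nat.Ioc_filter_modEq_card 0 M hq w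
  rw [← hset] at h
  have hq0 : (0 : ℚ) < q := by exact_mod_cast hq
  have h1 := Int.floor_le (((M : ℚ) - w) / q)
  have h2 := Int.lt_floor_add_one ((((0 : ℕ) : ℚ) - w) / q)
  have h3 : (0 : ℚ) ≤ M / q + 1 := by positivity
  have h4 : ((((Finset.Ioc 0 M).filter fun m : ℕ => (q : ℤ) ∣ (m : ℤ) - v).card : ℤ) : ℚ)
      ≤ M / q + 1 := by
    rw [h]
    push_cast at h2 ⊢
    refine max_le ?_ h3
    have h5 : ((M : ℚ) - w) / q - (0 - w) / q = M / q := by ring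
    linarith
  have h6 := (Rat.cast_le (K := ℝ)).mpr h4
  push_cast at h6
  exact h6

/-- The `m` in `1, …, M` for which `q` divides `(2m)² + a`. -/
def rootsUpTo (M q a : ℕ) : Finset ℕ :=
  (Finset.Ioc 0 M).filter fun m => q ∣ (2 * m) ^ 2 + a

/-- If r is one root, any root m has p² ∣ 4(m - r)(m + r). If p divided both factors it would divide
2m, hence a; so m ≡ ±r modulo p². -/
lemma card_rootsUpTo_sq_le {p a : ℕ} (M : ℕ) (hp : p.Prime) (h2 : p ≠ 2) (ha : ¬ p ∣ a) :
    ((rootsUpTo M (p ^ 2) a).card : ℝ) ≤ 2 * (M / (p : ℝ) ^ 2 + 1) := by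
  rcases (rootsUpTo M (p ^ 2) a).eq_empty_or_nonempty with h | ⟨r, hr⟩
  · rw [h]
    simp only [Finset.card_empty, Nat.cast_zero]
    positivity
  have hq : 0 < p ^ 2 := pow_pos hp.pos 2
  have hsub : rootsUpTo M (p ^ 2) a ⊆
      ((Finset.Ioc 0 M).filter fun m : ℕ => ((p ^ 2 : ℕ) : ℤ) ∣ (m : ℤ) - r) ∪
      ((Finset.Ioc 0 M).filter fun m : ℕ => ((p ^ 2 : ℕ) : ℤ) ∣ (m : ℤ) - (-r)) := by
    intro m hm
    simp only [rootsUpTo, Finset.mem_filter] at hm hr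
    rw [Finset.mem_union, Finset.mem_filter, Finset.mem_filter]
    have hpI : Prime (p : ℤ) := Nat.prime_iff_prime_int.mp hp
    have hm2 : ((p : ℤ) ^ 2) ∣ (2 * m) ^ 2 + a := by exact_mod_cast hm.2
    have hr2 : ((p : ℤ) ^ 2) ∣ (2 * r) ^ 2 + a := by exact_mod_cast hr.2
    have hp2 : ¬ (p : ℤ) ∣ 2 := by
      intro h
      exact h2 ((Nat.prime_dvd_prime_iff_eq hp Nat.prime_two).mp (by exact_mod_cast h))
    have hmul : ((p : ℤ) ^ 2) ∣ ((m : ℤ) - r) * (m - (-r)) := by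
      have h4 : ((p : ℤ) ^ 2) ∣ 4 * (((m : ℤ) - r) * (m - (-r))) := by
        have h := dvd_sub hm2 hr2
        rwa [show ((2 * m : ℤ) ^ 2 + a) - ((2 * r) ^ 2 + a) = 4 * ((m - r) * (m - (-r))) by ring]
          at h
      refine IsCoprime.dvd_of_dvd_mul_left (IsCoprime.pow_left ?_) h4
      rw [show (4 : ℤ) = 2 ^ 2 by norm_num]
      exact ((Prime.coprime_iff_not_dvd hpI).mpr hp2).pow_right
    by_cases hd : (p : ℤ) ∣ (m : ℤ) - r
    · by_cases hs : (p : ℤ) ∣ (m : ℤ) - (-r)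
      · exfalso
        have h2m : (p : ℤ) ∣ 2 * m := by
          have h := dvd_add hd hs
          rwa [show (m : ℤ) - r + (m - (-r)) = 2 * m by ring] at h
        have hpa : (p : ℤ) ∣ (2 * m) ^ 2 + a := (dvd_pow_self _ two_ne_zero).trans hm2
        rw [dvd_add_right (dvd_pow h2m two_ne_zero)] at hpa
        exact ha (by exact_mod_cast hpa)
      · left
        refine ⟨hm.1, ?_⟩
        push_cast
        exact IsCoprime.dvd_of_dvd_mul_right
          (((Prime.coprime_iff_not_dvd hpI).mpr hs).pow_left) hmul
    · right
      refine ⟨hm.1, ?_⟩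
      push_cast
      exact IsCoprime.dvd_of_dvd_mul_left
        (((Prime.coprime_iff_not_dvd hpI).mpr hd).pow_left) hmul
  have h3 : ((rootsUpTo M (p ^ 2) a).card : ℝ) ≤ _ :=
    Nat.cast_le.mpr ((Finset.card_le_card hsub).trans (Finset.card_union_le _ _))
  have h4 := card_filter_dvd_sub_le M (p ^ 2) hq r
  have h5 := card_filter_dvd_sub_le M (p ^ 2) hq (-r)
  push_cast at h3 h4 h5
  linarith

/-- Telescoping, from (2k + 1)² ≥ 4k(k + 1). -/
lemma sum_inv_odd_sq_le {M : ℕ} (hM : 14 ≤ M) :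
    ∑ k ∈ Finset.Ico 14 M, 1 / ((2 * k + 1 : ℕ) : ℝ) ^ 2 ≤ 1 / 56 - 1 / (4 * (M : ℝ)) := by
  induction M, hM using Nat.le_induction with
  | base => norm_num
  | succ n hn ih =>
    rw [Finset.sum_Ico_succ_top hn]
    have hn0 : (0 : ℝ) < n := by
      have : 0 < n := by omega
      exact_mod_cast this
    have h : 1 / ((2 * n + 1 : ℕ) : ℝ) ^ 2 ≤ 1 / (4 * n) - 1 / (4 * ((n + 1 : ℕ) : ℝ)) := by
      push_cast
      rw [div_sub_div _ _ (by positivity) (by positivity), div_le_div_iff₀ (by positivity)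
        (by positivity)]
      nlinarith
    linarith

/-- The primes `p` with `7 ≤ p ≤ n`. -/
def primesFromSeven (n : ℕ) : Finset ℕ := (Finset.Icc 7 n).filter Nat.Prime

lemma primesFromSeven_subset {M N : ℕ} (hN : M ≤ N) :
    primesFromSeven (2 * M) ⊆
      {7, 11, 13, 17, 19, 23} ∪ (Finset.Ico 14 N).image fun k => 2 * k + 1 := by
  intro p hp
  simp only [primesFromSeven, Finset.mem_filter, Finset.mem_Icc] at hp
  obtain ⟨⟨h7, hM⟩, hp⟩ := hp
  rw [Finset.mem_union]
  by_cases h29 : p < 29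
  · left
    clear hM
    interval_cases p <;> first | decide | (exfalso; revert hp; decide)
  -- The first odd number covered by the tail is 29 = 2 · 14 + 1.
  · right
    obtain ⟨k, hk⟩ := hp.odd_of_ne_two (by omega)
    rw [Finset.mem_image]
    exact ⟨k, Finset.mem_Ico.mpr ⟨by omega, by omega⟩, hk.symm⟩

lemma sum_union_le_add {s t : Finset ℕ} {f : ℕ → ℝ} (hf : ∀ n, 0 ≤ f n) :
    ∑ n ∈ s ∪ t, f n ≤ ∑ n ∈ s, f n + ∑ n ∈ t, f n := by
  rw [← Finset.sum_union_inter]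
  exact le_add_of_nonneg_right (Finset.sum_nonneg fun n _ => hf n)

lemma sum_inv_sq_primesFromSeven_le (M : ℕ) :
    ∑ p ∈ primesFromSeven (2 * M), 1 / (p : ℝ) ^ 2 ≤ 0.0607 := by
  obtain ⟨N, h14, hN⟩ : ∃ N, 14 ≤ N ∧ M ≤ N := ⟨max 14 M, le_max_left _ _, le_max_right _ _⟩
  have hnn : ∀ p : ℕ, (0 : ℝ) ≤ 1 / (p : ℝ) ^ 2 := fun p => by positivity
  have hodd := sum_inv_odd_sq_le h14
  have hpos : (0 : ℝ) ≤ 1 / (4 * (N : ℝ)) := by positivity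
  have hsmall : ∑ p ∈ ({7, 11, 13, 17, 19, 23} : Finset ℕ), 1 / (p : ℝ) ^ 2 ≤ 0.0428 := by
    norm_num
  have himage : ∑ p ∈ (Finset.Ico 14 N).image (fun k : ℕ => 2 * k + 1), 1 / ((p : ℕ) : ℝ) ^ 2 =
      ∑ k ∈ Finset.Ico 14 N, 1 / ((2 * k + 1 : ℕ) : ℝ) ^ 2 :=
    Finset.sum_image fun a _ b _ h => by simpa using h
  refine (Finset.sum_le_sum_of_subset_of_nonneg (primesFromSeven_subset hN)
    fun p _ _ => hnn p).trans ((sum_union_le_add hnn).trans ?_)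
  rw [himage]
  refine (add_le_add hsmall hodd).trans ?_
  -- 0.0428 + 1/56 < 0.0607.
  linarith

lemma card_primesFromSeven_le (n : ℕ) : (primesFromSeven n).card ≤ n.primeCounting := by
  rw [← Nat.primesLE_card_eq_primeCounting]
  refine Finset.card_le_card fun p hp => ?_
  simp only [primesFromSeven, Finset.mem_filter, Finset.mem_Icc] at hp
  exact Nat.mem_primesLE.mpr ⟨hp.1.2, hp.2⟩

lemma eventually_primeCounting_le_mul {δ : ℝ} (hδ : 0 < δ) :
    ∀ᶠ n : ℕ in atTop, (n.primeCounting : ℝ) ≤ δ * n := by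
  have h1 := (tendsto_natCast_atTop_atTop (R := ℝ)).eventually
    (Chebyshev.eventually_primeCounting_le one_pos)
  have h2 := (Real.tendsto_log_atTop.comp (tendsto_natCast_atTop_atTop (R := ℝ))).eventually
    (eventually_ge_atTop ((Real.log 4 + 1) / δ))
  have h3 := (Real.tendsto_log_atTop.comp (tendsto_natCast_atTop_atTop (R := ℝ))).eventually
    (eventually_gt_atTop 0)
  filter_upwards [h1, h2, h3] with n h1 h2 h3
  simp only [Function.comp_apply, Nat.floor_natCast] at h1 h2 h3
  refine h1.trans ?_
  rw [div_le_iff₀ hδ] at h2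
  rw [div_le_iff₀ h3]
  have : (0 : ℝ) ≤ n := Nat.cast_nonneg n
  nlinarith

/-- `n² + 1`, `n² + 2` and `n² + 3` are all squarefree. -/
def IsSquarefreeTriple (n : ℕ) : Prop :=
  Squarefree (n ^ 2 + 1) ∧ Squarefree (n ^ 2 + 2) ∧ Squarefree (n ^ 2 + 3)

open Classical in
lemma squarefreeTripleSum_eq_card (X : ℝ) :
    squarefreeTripleSum X = ((Finset.Icc 1 ⌊X⌋₊).filter IsSquarefreeTriple).card := by
  rw [squarefreeTripleSum, Finset.card_filter, Nat.cast_sum]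
  refine Finset.sum_congr rfl fun n _ => ?_
  simp only [ArithmeticFunction.moebius_sq, IsSquarefreeTriple]
  split_ifs <;> simp_all

open Classical in
lemma card_even_le_squarefreeTripleSum {X : ℝ} {M : ℕ} (hM : 2 * M ≤ ⌊X⌋₊) :
    (((Finset.Ioc 0 M).filter fun m => IsSquarefreeTriple (2 * m)).card : ℤ) ≤
      squarefreeTripleSum X := by
  rw [squarefreeTripleSum_eq_card, Nat.cast_le]
  refine Finset.card_le_card_of_injOn (fun m => 2 * m) ?_ fun a _ b _ h => by simpa using h
  intro m hm
  simp only [Finset.coe_filter, Set.mem_ofPred_eq, Finset.mem_Ioc, Finset.mem_Icc] at hm ⊢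
  exact ⟨by omega, hm.2⟩

/-- The obstruction at small primes: `p = 3` only matters for `n² + 2`, `p = 5` only for `n² + 1`,
and `p = 2` for none of the three when `n` is even. -/
lemma mem_rootsUpTo_of_sq_dvd {M m a p : ℕ} (hm : m ∈ Finset.Ioc 0 M) (ha : a ∈ Finset.Icc 1 3)
    (hp : p.Prime) (hd : p * p ∣ (2 * m) ^ 2 + a) :
    m ∈ rootsUpTo M (3 ^ 2) 2 ∪ rootsUpTo M (5 ^ 2) 1 ∪
      (primesFromSeven (2 * M)).biUnion fun p =>
        (Finset.Icc 1 3).biUnion fun a => rootsUpTo M (p ^ 2) a := by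
  have hm' := Finset.mem_Ioc.mp hm
  have ha' := Finset.mem_Icc.mp ha
  simp only [Finset.mem_union, Finset.mem_biUnion]
  by_cases h7 : 7 ≤ p
  · right
    refine ⟨p, ?_, a, ha, Finset.mem_filter.mpr ⟨hm, by rwa [pow_two p]⟩⟩
    rw [primesFromSeven, Finset.mem_filter, Finset.mem_Icc]
    refine ⟨⟨h7, ?_⟩, hp⟩
    have h1 := Nat.le_of_dvd (Nat.add_pos_right _ ha'.1) hd
    -- If p ≥ 2M + 1, then p² ≥ 4M² + 4M + 1 > 4M² + 3.
    by_contra! h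
    nlinarith
  · left
    have hp' : p = 2 ∨ p = 3 ∨ p = 5 := by
      have := hp.two_le
      interval_cases p <;> first | decide | (exfalso; revert hp; decide)
    have hmod : ∀ q : ℕ, (2 * m) ^ 2 % q = (2 * (m % q)) ^ 2 % q := fun q => by
      simp [Nat.pow_mod, Nat.mul_mod]
    obtain ⟨ha1, ha3⟩ := ha'
    rcases hp' with rfl | rfl | rfl
    · have h := hmod 4
      have hlt : m % 4 < 4 := Nat.mod_lt _ (by norm_num)
      generalize m % 4 = r at h hlt
      interval_cases r <;> interval_cases a <;> norm_num at h hd <;> omega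
    · left
      have h := hmod 9
      have hlt : m % 9 < 9 := Nat.mod_lt _ (by norm_num)
      have ha2 : a = 2 := by
        generalize m % 9 = r at h hlt
        interval_cases r <;> interval_cases a <;> norm_num at h hd ⊢ <;> omega
      subst ha2
      exact Finset.mem_filter.mpr ⟨hm, hd⟩
    · right
      -- Modulo 5 is enough: -2 and -3 are not squares there. For p = 3 the modulus 9 is needed to
      -- exclude a = 3.
      have h := hmod 5
      have hlt : m % 5 < 5 := Nat.mod_lt _ (by norm_num)
      have ha2 : a = 1 := by
        generalize m % 5 = r at h hlt
        interval_cases r <;> interval_cases a <;> norm_num at h hd ⊢ <;> omega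
      subst ha2
      exact Finset.mem_filter.mpr ⟨hm, hd⟩

open Classical in
lemma filter_not_isSquarefreeTriple_subset (M : ℕ) :
    ((Finset.Ioc 0 M).filter fun m => ¬ IsSquarefreeTriple (2 * m)) ⊆
      rootsUpTo M (3 ^ 2) 2 ∪ rootsUpTo M (5 ^ 2) 1 ∪
        (primesFromSeven (2 * M)).biUnion fun p =>
          (Finset.Icc 1 3).biUnion fun a => rootsUpTo M (p ^ 2) a := by
  intro m hm
  obtain ⟨hm, hbad⟩ := Finset.mem_filter.mp hm
  have key : ∃ a ∈ Finset.Icc 1 3, ¬ Squarefree ((2 * m) ^ 2 + a) := by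
    by_contra! h
    exact hbad ⟨h 1 (by decide), h 2 (by decide), h 3 (by decide)⟩
  obtain ⟨a, ha, hsq⟩ := key
  rw [Nat.squarefree_iff_prime_squarefree] at hsq
  push Not at hsq
  obtain ⟨p, hp, hd⟩ := hsq
  exact mem_rootsUpTo_of_sq_dvd hm ha hp hd

lemma card_biUnion_rootsUpTo_le (M : ℕ) :
    (((primesFromSeven (2 * M)).biUnion fun p =>
      (Finset.Icc 1 3).biUnion fun a => rootsUpTo M (p ^ 2) a).card : ℝ) ≤
      0.3642 * M + 6 * (2 * M).primeCounting := by
  have hp : ∀ p ∈ primesFromSeven (2 * M),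
      (((Finset.Icc 1 3).biUnion fun a => rootsUpTo M (p ^ 2) a).card : ℝ) ≤
        6 * M * (1 / (p : ℝ) ^ 2) + 6 := by
    intro p hp
    simp only [primesFromSeven, Finset.mem_filter, Finset.mem_Icc] at hp
    have ha : ∀ a ∈ Finset.Icc 1 3,
        ((rootsUpTo M (p ^ 2) a).card : ℝ) ≤ 2 * (M / (p : ℝ) ^ 2 + 1) := fun a ha => by
      have ha' := Finset.mem_Icc.mp ha
      exact card_rootsUpTo_sq_le M hp.2 (by omega) fun h => by
        have := Nat.le_of_dvd (by omega) h
        omega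
    calc (((Finset.Icc 1 3).biUnion fun a => rootsUpTo M (p ^ 2) a).card : ℝ)
        ≤ ∑ a ∈ Finset.Icc 1 3, ((rootsUpTo M (p ^ 2) a).card : ℝ) := by
          exact_mod_cast Finset.card_biUnion_le
      _ ≤ ∑ a ∈ Finset.Icc 1 3, 2 * (M / (p : ℝ) ^ 2 + 1) := Finset.sum_le_sum ha
      _ = 6 * M * (1 / (p : ℝ) ^ 2) + 6 := by
          rw [Finset.sum_const, Nat.card_Icc, nsmul_eq_mul]
          push_cast
          ring
  have hM : (0 : ℝ) ≤ M := Nat.cast_nonneg M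
  have h1 := sum_inv_sq_primesFromSeven_le M
  have h2 : ((primesFromSeven (2 * M)).card : ℝ) ≤ (2 * M).primeCounting := by
    exact_mod_cast card_primesFromSeven_le (2 * M)
  calc (((primesFromSeven (2 * M)).biUnion fun p =>
      (Finset.Icc 1 3).biUnion fun a => rootsUpTo M (p ^ 2) a).card : ℝ)
      ≤ ∑ p ∈ primesFromSeven (2 * M),
        (((Finset.Icc 1 3).biUnion fun a => rootsUpTo M (p ^ 2) a).card : ℝ) := by
        exact_mod_cast Finset.card_biUnion_le
    _ ≤ ∑ p ∈ primesFromSeven (2 * M), (6 * M * (1 / (p : ℝ) ^ 2) + 6) := Finset.sum_le_sum hp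
    _ = 6 * M * ∑ p ∈ primesFromSeven (2 * M), 1 / (p : ℝ) ^ 2 +
        6 * (primesFromSeven (2 * M)).card := by
        rw [Finset.sum_add_distrib, ← Finset.mul_sum, Finset.sum_const, nsmul_eq_mul, mul_comm 6]
        ring
    _ ≤ 0.3642 * M + 6 * (2 * M).primeCounting := by nlinarith

open Classical in
lemma card_isSquarefreeTriple_even_ge (M : ℕ) :
    0.333 * (M : ℝ) - 4 - 6 * (2 * M).primeCounting ≤
      ((Finset.Ioc 0 M).filter fun m => IsSquarefreeTriple (2 * m)).card := by
  have h := Finset.card_filter_add_card_filter_not (s := Finset.Ioc 0 M)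
    (fun m => IsSquarefreeTriple (2 * m))
  rw [Nat.card_Ioc, Nat.sub_zero] at h
  have hbad := (Finset.card_le_card (filter_not_isSquarefreeTriple_subset M)).trans
    ((Finset.card_union_le _ _).trans (Nat.add_le_add_right (Finset.card_union_le _ _) _))
  have h3 := card_rootsUpTo_sq_le M Nat.prime_three (a := 2) (by norm_num) (by norm_num)
  have h5 := card_rootsUpTo_sq_le M Nat.prime_five (a := 1) (by norm_num) (by norm_num)
  have h7 := card_biUnion_rootsUpTo_le M
  have h' : ((_ + _ : ℕ) : ℝ) = _ := congrArg Nat.cast h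
  have hbad' : ((_ : ℕ) : ℝ) ≤ _ := Nat.cast_le.mpr hbad
  push_cast at h' hbad' h3 h5
  have hM : (0 : ℝ) ≤ M := Nat.cast_nonneg M
  -- 1 - 2/9 - 2/25 - 0.3642 > 0.333; the primes 3 and 5 contribute the error 4.
  linarith

theorem mainTheorem3 :
    ∃ α : ℝ, 0.1477 < α ∧ ∀ᶠ X : ℝ in atTop, α * X < (squarefreeTripleSum X : ℝ) := by
  classical
  refine ⟨0.15, by norm_num, ?_⟩
  have hhalf : Tendsto (fun X : ℝ => 2 * (⌊X⌋₊ / 2)) atTop atTop :=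
    (tendsto_atTop_mono (fun n : ℕ => show n - 1 ≤ 2 * (n / 2) by omega)
      (tendsto_sub_atTop_nat 1)).comp tendsto_nat_floor_atTop
  filter_upwards [hhalf.eventually (eventually_primeCounting_le_mul (δ := 0.0025) (by norm_num)),
    eventually_gt_atTop 10000] with X hπ hX
  set M := ⌊X⌋₊ / 2 with hMdef
  have h1 : (((Finset.Ioc 0 M).filter fun m => IsSquarefreeTriple (2 * m)).card : ℝ) ≤
      squarefreeTripleSum X := by
    exact_mod_cast card_even_le_squarefreeTripleSum (X := X) (M := M) (by omega)
  have h2 := card_isSquarefreeTriple_even_ge M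
  have h3 : X < 2 * (M : ℝ) + 2 := by
    have h : ⌊X⌋₊ + 1 ≤ 2 * M + 2 := by omega
    have h' : ((⌊X⌋₊ : ℝ) + 1) ≤ 2 * M + 2 := by exact_mod_cast h
    exact (Nat.lt_floor_add_one X).trans_le h'
  push_cast at hπ
  -- The prime count costs 6 · 0.0025 · 2M = 0.03M, leaving 0.303M - 4 with M > X/2 - 1, which
  -- exceeds 0.15X for X > 10000.
  linarith
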